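/- Let $k\ge 1$, $t\ge 0$, $n\ge 1$ be integers, let $a_0,a_1,\dots,a_t$ be elements of a commutative ring $R$ with unity, and put $m=\min(n,t)$. Notation. $i^{\langle l\rangle}$ denotes $i$ repeated $l$ times. For $s\ge 0$ and $0\le r\le ks$ let $$G_{r,s}^{[k]}=\Bigl\{(1^{\langle l_1\rangle},2^{\langle l_2\rangle},\dots,s^{\langle l_s\rangle})\ :\ 0\le l_i\le k,\ \sum_{i=1}^{s} l_i=r\Bigr\},$$ and let $m_\alpha(i)$ be the number of components of the vector $\alpha$ equal to $i$; if $s\le t$, then $G_{r,s}^{[k]}\subseteq G_{r,t}^{[k]}$. Let $T_N^{(i)}$ be the $N\times N$ matrix with entry $1$ at the positions $(u,v)$ with $v-u=i$ and $0$ elsewhere, let $J_k$ be the $k\times k$ all-ones matrix, $N_{p}=\{1,\dots,p\}$, and let $A[S\mid v]$ be the matrix formed from the rows of $A$ with numbers in $S$ and the columns of $A$ with the numbers listed, with repetitions, in the vector $v$. For an integer $c$, an integer $d$ and an integer vector $\alpha$, $c\alpha$ and $d+\alpha$ are formed componentwise. The square matrix $\Pi_{r,t}^{[k]}(a_0,\dots,a_t)$,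 with rows and columns indexed by $G_{r,t}^{[k]}$, is defined as follows. For $t=0$ (and $r=0$) its only entry is $k!\,a_0^k$. For $t\ge1$ and $\alpha=(1^{\langle l_1\rangle},\dots,t^{\langle l_t\rangle})$, the entry in row $\alpha$ and column $\beta$ is $$k!\binom{k}{q}\prod_{i=1}^{t-1}\binom{l_i}{p_i}\cdot a_0^{\,k-q}\,a_1^{p_1}\cdots a_{t-1}^{p_{t-1}}\,a_t^{l_t},\qquad q=l_t+\sum_{i=1}^{t-1}p_i,$$ if $\beta=(1^{\langle q\rangle},2^{\langle l_1-p_1\rangle},3^{\langle l_2-p_2\rangle},\dots,t^{\langle l_{t-1}-p_{t-1}\rangle})$ for some (necessarily unique) integers $p_i$ with $0\le p_i\le l_i$ and $q\le k$, and it is $0$ if there are no such $p_i$. Theorem. Let $0\le r\le km$, $\beta\in G_{r,m}^{[k]}$ and $\alpha\in G_{r,t}^{[k]}$. Then $$\operatorname{per}\Bigl(\Bigl(\bigl(\textstyle\sum_{i=0}^{t}a_iT_{n+t}^{(i)}\bigr)\otimes J_k\Bigr)\bigl[N_{nk}\mid k(1^{\langle k-m_\beta(1)\rangle},\dots,m^{\langle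 k-m_\beta(m)\rangle}),\,mk+1,mk+2,\dots,nk,\,nk+k\alpha\bigr]\Bigr)=\Bigl(\prod_{i=1}^{m}\binom{k}{m_\beta(i)}^{-1}\Bigr)\bigl(\Pi_{r,t}^{[k]}(a_0,\dots,a_t)\bigr)^n_{\alpha,\beta},$$ where $(\cdot)_{\alpha,\beta}$ denotes the entry in row $\alpha$ and column $\beta$. If the binomial coefficients are not invertible in $R$, the right-hand side is understood generically: for independent variables $X_0,\dots,X_t$ the entry $\bigl(\Pi_{r,t}^{[k]}(X_0,\dots,X_t)\bigr)^n_{\alpha,\beta}\in\mathbb Z[X_0,\dots,X_t]$ is divisible by $\prod_{i=1}^m\binom{k}{m_\beta(i)}$ in $\mathbb Z[X_0,\dots,X_t]$, and the right-hand side is the value of the (unique) quotient at $X_i=a_i$. In particular, in every $R$, $\prod_{i=1}^m\binom{k}{m_\beta(i)}$ times the permanent equals $\bigl(\Pi_{r,t}^{[k]}(a_0,\dots,a_t)\bigr)^n_{\alpha,\beta}$. -/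

import Mathlib

open scoped Kronecker Nat

namespace ToeplitzPermanent

/-- `G k r t` is the set of the nondecreasing vectors `(1^{l_1}, 2^{l_2}, ..., t^{l_t})`
(each `i` repeated `l_i` times) with `0 ≤ l_i ≤ k` and `l_1 + ... + l_t = r`. Such a vector is
given by its multiplicities; the index `i : Fin t` stands for the component `i + 1`. -/
abbrev G (k r t : ℕ) : Type :=
  {l : Fin t → Fin (k + 1) // ∑ i, (l i : ℕ) = r}

/-- The number of components of the vector `α` that are equal to `i + 1`. -/
def mult {k r t : ℕ} (α : G k r t) (i : Fin t) : ℕ := (α.1 i : ℕ)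

/-- The vector `(1^{l_1}, 2^{l_2}, ..., t^{l_t})` itself, from its multiplicities. -/
def vec {t : ℕ} (l : Fin t → ℕ) : List ℕ :=
  (List.finRange t).flatMap fun i => List.replicate (l i) ((i : ℕ) + 1)

/-- For `m ≤ t`, a vector with components in `{1, ..., m}` regarded as a vector with components
in `{1, ..., t}` (in which `m + 1, ..., t` do not occur). -/
def pad {k r m t : ℕ} (h : m ≤ t) (β : G k r m) : G k r t :=
  ⟨fun i => if hi : (i : ℕ) < m then β.1 ⟨i, hi⟩ else 0, by
    obtain ⟨d, rfl⟩ := Nat.exists_eq_add_of_le h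
    rw [Fin.sum_univ_add]
    simpa using β.2⟩

/-- The matrix `T_n^{(s)}` of order `n`: the entry `(i, j)` is `1` if `j - i = s`
and `0` otherwise. -/
def T (R : Type*) [CommRing R] (n : ℕ) (s : ℤ) : Matrix (Fin n) (Fin n) R :=
  Matrix.of fun i j => if ((j : ℕ) : ℤ) - ((i : ℕ) : ℤ) = s then 1 else 0

/-- The square matrix of order `k` with all elements equal to `1`. -/
def J (R : Type*) [CommRing R] (k : ℕ) : Matrix (Fin k) (Fin k) R :=
  Matrix.of fun _ _ => 1

/-- The matrix `(∑_{i=0}^t a_i T_N^{(i)}) ⊗ J_k` of order `N k`, with the usual block numbering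
of rows and columns: `(u, v)` gets the number `k u + v`, counted from `0`. -/
def toeplitzKronecker {R : Type*} [CommRing R] {t : ℕ} (N k : ℕ) (a : Fin (t + 1) → R) :
    Matrix (Fin (N * k)) (Fin (N * k)) R :=
  Matrix.reindex finProdFinEquiv finProdFinEquiv
    ((∑ i : Fin (t + 1), a i • T R N (((i : ℕ) : ℤ))) ⊗ₖ J R k)

/-- The entry `a_{α, β}` of `Π_{r,t}^{[k]}(a_0, ..., a_t)`. For `t = s + 1 ≥ 1` it is nonzero only
if `β = (1^{l_t + p_1 + ... + p_{t-1}}, 2^{l_1 - p_1}, ..., t^{l_{t-1} - p_{t-1}})` with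
`0 ≤ p_i ≤ l_i` and `p_1 + ... + p_{t-1} ≤ k - l_t`. Such `p_i` must be
`l_i - m_β(i + 1)`, with `m_β(i + 1) ≤ l_i`. -/
def piEntry {R : Type*} [CommRing R] (k r : ℕ) :
    (t : ℕ) → (Fin (t + 1) → R) → G k r t → G k r t → R
  | 0, a, _, _ => (k ! : R) * a 0 ^ k
  | s + 1, a, α, β =>
    let l : Fin (s + 1) → ℕ := mult α
    let p : Fin s → ℕ := fun i => l i.castSucc - mult β i.succ
    let q : ℕ := l (Fin.last s) + ∑ i, p i
    if (∀ i : Fin s, mult β i.succ ≤ l i.castSucc) ∧ mult β 0 = q ∧ q ≤ k then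
      (k ! : R) * (k.choose q : R) * (∏ i : Fin s, ((l i.castSucc).choose (p i) : R)) *
        a 0 ^ (k - q) * (∏ i : Fin s, a i.castSucc.succ ^ p i) *
        a (Fin.last (s + 1)) ^ l (Fin.last s)
    else 0

/-- The square matrix `Π_{r,t}^{[k]}(a_0, ..., a_t)` on the set `G k r t`. -/
def piMatrix {R : Type*} [CommRing R] (k r t : ℕ) (a : Fin (t + 1) → R) :
    Matrix (G k r t) (G k r t) R :=
  Matrix.of (piEntry k r t a)

/-- The vector of column numbers (counted from `1`), where `m = min(n, t)`:
`k (1^{k - m_β(1)}, ..., m^{k - m_β(m)}), m k + 1, m k + 2, ..., n k, n k + k α`. -/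
def columnVector {n t k r : ℕ} (β : G k r (min n t)) (α : G k r t) : List ℕ :=
  (vec fun i => k - mult β i).map (fun x => k * x) ++
    List.range' (min n t * k + 1) ((n - min n t) * k) ++
    (vec (mult α)).map (fun x => n * k + k * x)

theorem length_vec {t : ℕ} (l : Fin t → ℕ) : (vec l).length = ∑ i, l i := by
  simp [vec, List.length_flatMap, Fin.sum_univ_def]

theorem mem_vec {t : ℕ} (l : Fin t → ℕ) {x : ℕ} (hx : x ∈ vec l) : 1 ≤ x ∧ x ≤ t := by
  simp only [vec, List.mem_flatMap, List.mem_replicate] at hx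
  obtain ⟨i, _, _, rfl⟩ := hx
  have := i.2
  omega

theorem length_columnVector {n t k r : ℕ} (β : G k r (min n t)) (α : G k r t) :
    (columnVector β α).length = n * k := by
  have h1 : ∑ i, (k - mult β i) + ∑ i, mult β i = min n t * k := by
    rw [← Finset.sum_add_distrib, Finset.sum_congr rfl (g := fun _ => k)]
    · simp
    · intro i _
      have := (β.1 i).2
      unfold mult
      omega
  have h2 : ∑ i, mult β i = r := β.2
  have h3 : ∑ i, mult α i = r := α.2
  have h4 : (n - min n t) * k + min n t * k = n * k := by
    rw [← Nat.add_mul, Nat.sub_add_cancel (Nat.min_le_left n t)]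
  simp only [columnVector, List.length_append, List.length_map, length_vec, List.length_range']
  omega

theorem mem_columnVector {n t k r : ℕ} (hk : 1 ≤ k) (β : G k r (min n t)) (α : G k r t)
    {c : ℕ} (hc : c ∈ columnVector β α) : 1 ≤ c ∧ c ≤ (n + t) * k := by
  have h4 : (n - min n t) * k + min n t * k = n * k := by
    rw [← Nat.add_mul, Nat.sub_add_cancel (Nat.min_le_left n t)]
  simp only [columnVector, List.mem_append, List.mem_map, List.mem_range'_1] at hc
  rw [Nat.add_mul]
  rcases hc with (⟨x, hx, rfl⟩ | hc) | ⟨x, hx, rfl⟩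
  · obtain ⟨hx1, hx2⟩ := mem_vec _ hx
    have h5 : k * x ≤ k * n := Nat.mul_le_mul_left k (hx2.trans (Nat.min_le_left n t))
    have h6 : 1 ≤ k * x := Nat.mul_pos hk hx1
    rw [Nat.mul_comm k n] at h5
    omega
  · omega
  · obtain ⟨hx1, hx2⟩ := mem_vec _ hx
    have h5 : k * x ≤ k * t := Nat.mul_le_mul_left k hx2
    have h6 : 1 ≤ k * x := Nat.mul_pos hk hx1
    rw [Nat.mul_comm k t] at h5
    omega

/-- The `j`-th selected column, as a column index (counted from `0`) of a matrix of order
`(n + t) k`. -/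
def columnIndex {n t k r : ℕ} (hk : 1 ≤ k) (β : G k r (min n t)) (α : G k r t)
    (j : Fin (n * k)) : Fin ((n + t) * k) :=
  ⟨(columnVector β α).get (j.cast (length_columnVector β α).symm) - 1, by
    have h := mem_columnVector hk β α
      (List.get_mem (columnVector β α) (j.cast (length_columnVector β α).symm))
    omega⟩

/-- The submatrix `((∑_{i=0}^t a_i T_{n+t}^{(i)}) ⊗ J_k)[N_{nk} | columnVector β α]`: the first
`n k` rows and the columns listed, with repetitions, in `columnVector β α`. -/
def columnSubmatrix {R : Type*} [CommRing R] {n t k r : ℕ} (hk : 1 ≤ k) (a : Fin (t + 1) → R)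
    (β : G k r (min n t)) (α : G k r t) : Matrix (Fin (n * k)) (Fin (n * k)) R :=
  (toeplitzKronecker (n + t) k a).submatrix
    (Fin.castLE (Nat.mul_le_mul_right k (Nat.le_add_right n t))) (columnIndex hk β α)

end ToeplitzPermanent

namespace ToeplitzPermanent

/-! Let `L_u = ∑ a_i X_{u+i}` be the linear form of a row in block `u`. A permanent with repeated
columns is the product of the factorials of the column multiplicities times one coefficient of the
product of the row forms, here `∏_{u<n} L_u^k` (`permanent_eq_coeff`). The selected columns,
together with the monomial `X^β`, have exponent vector `(k, ..., k, α)` with `n` entries `k`, so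
that coefficient is `transfer a n α β`, the coefficient of this monomial in `X^β ∏_{u<n} L_u^k`.

The variable `X_0` can occur only in `X^β L_0^k`. Fixing its exponent at `k` and shifting the other
variables down leaves the same problem for `n - 1` blocks, with some `γ` in place of `β`. Hence
`transfer` is multiplicative in `n` (`transfer_succ`). For `n = 1` the multinomial theorem shows
that it is `Π` up to the factor `k!` and conjugation by the diagonal matrix of the `∏ m_α(i)!`
(`piEntry_eq_transfer`).

Comparing factorials gives the theorem multiplied by `∏ m_β(i)!`. This factor is cancelled in
`ℤ[X_0, ..., X_t]`, and the identity is then specialised to `R`. -/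

open MvPolynomial Finset

/-! ### Permanents with repeated columns as coefficients -/

/-- Two functions on a finite type with the same fibre cardinalities differ by a permutation. -/
theorem exists_perm_comp_eq {ι κ : Type*} [Fintype ι] [DecidableEq κ] {f g : ι → κ}
    (h : ∀ v, #{i | f i = v} = #{i | g i = v}) : ∃ σ : Equiv.Perm ι, f ∘ σ = g := by
  let e : ∀ v, {i // g i = v} ≃ {i // f i = v} := fun v =>
    Fintype.equivOfCardEq (by rw [Fintype.card_subtype, Fintype.card_subtype, h v])
  refine ⟨(Equiv.sigmaFiberEquiv g).symm.trans
    ((Equiv.sigmaCongrRight e).trans (Equiv.sigmaFiberEquiv f)), ?_⟩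
  funext i
  exact (e (g i) ⟨i, rfl⟩).2

theorem card_perm_comp_eq_self {ι : Type*} [Fintype ι] [DecidableEq ι] (S : Finset ℕ)
    (f : ι → ℕ) (hf : ∀ i, f i ∈ S) :
    #{σ : Equiv.Perm ι | f ∘ σ = f} = ∏ v ∈ S, (#{i | f i = v})! := by
  rw [← Fintype.card_subtype, DomMulAct.stabilizer_card']
  simp only [Fintype.card_subtype]
  -- Values in `S` that `f` does not take contribute `0! = 1`.
  refine prod_subset (fun v hv => ?_) fun v _ hv => ?_
  · obtain ⟨i, -, rfl⟩ := mem_image.1 hv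
    exact hf i
  · rw [Finset.card_eq_zero.2, Nat.factorial_zero]
    exact filter_eq_empty_iff.2 fun i _ hi => hv (mem_image.2 ⟨i, mem_univ _, hi⟩)

theorem sum_single_one_apply {ι : Type*} [Fintype ι] (f : ι → ℕ) (v : ℕ) :
    (∑ i, Finsupp.single (f i) 1 : ℕ →₀ ℕ) v = #{i | f i = v} := by
  simp [Finsupp.finsetSum_apply, Finsupp.single_apply]

/-- The sums of `Finsupp.single` record the fibre sizes. If they agree, some `τ` has `f ∘ τ = g`,
and the solutions `σ` form a coset of the stabilizer of `f`; if not, there is no solution. -/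
theorem card_perm_comp_eq {ι : Type*} [Fintype ι] [DecidableEq ι] (S : Finset ℕ)
    (f g : ι → ℕ) (hf : ∀ i, f i ∈ S) :
    #{σ : Equiv.Perm ι | f ∘ σ = g} =
      if (∑ i, Finsupp.single (g i) 1 : ℕ →₀ ℕ) = ∑ i, Finsupp.single (f i) 1 then
        ∏ v ∈ S, (#{i | f i = v})! else 0 := by
  split_ifs with h
  · obtain ⟨τ, hτ⟩ := exists_perm_comp_eq (f := f) (g := g) fun v => by
      rw [← sum_single_one_apply, ← sum_single_one_apply, h]
    rw [← card_perm_comp_eq_self S f hf]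
    refine card_bij (fun σ _ => σ * τ⁻¹) ?_ ?_ ?_
    · intro σ hσ
      simp only [mem_filter, mem_univ, true_and] at hσ ⊢
      funext i
      have h1 := congrFun hσ (τ⁻¹ i)
      have h2 := congrFun hτ (τ⁻¹ i)
      simp only [Function.comp_apply, Equiv.Perm.coe_mul] at h1 h2 ⊢
      rw [h1, ← h2, Equiv.Perm.inv_def, Equiv.apply_symm_apply]
    · intro σ _ σ' _ h
      exact mul_right_cancel h
    · intro σ hσ
      simp only [mem_filter, mem_univ, true_and] at hσ
      refine ⟨σ * τ, ?_, by simp⟩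
      simp only [mem_filter, mem_univ, true_and]
      rw [Equiv.Perm.coe_mul, ← Function.comp_assoc, hσ, hτ]
  · rw [Finset.card_eq_zero, filter_eq_empty_iff]
    rintro σ - rfl
    exact h (Equiv.sum_comp σ fun i => Finsupp.single (f i) 1)

/-- The permanent of a matrix with repeated columns as a coefficient of the product of the linear
forms given by its rows. -/
theorem permanent_eq_coeff {R ι : Type*} [CommRing R] [Fintype ι] [DecidableEq ι] (S : Finset ℕ)
    (A : ι → ℕ → R) (f : ι → ℕ) (hf : ∀ i, f i ∈ S) :
    (Matrix.of fun i j => A i (f j)).permanent =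
      ((∏ v ∈ S, (#{i | f i = v})! : ℕ) : R) *
        coeff (∑ i, Finsupp.single (f i) 1) (∏ i, ∑ v ∈ S, C (A i v) * X v) := by
  have h1 : (Matrix.of fun i j => A i (f j)).permanent =
      ∑ σ : Equiv.Perm ι, ∏ i, A i ((f ∘ σ) i) := by
    rw [← Matrix.permanent_transpose]
    rfl
  have h2 : ∀ σ ∈ (univ : Finset (Equiv.Perm ι)), f ∘ σ ∈ Fintype.piFinset fun _ => S :=
    fun σ _ => Fintype.mem_piFinset.2 fun i => hf _
  -- Both sides become sums over functions `g : ι → S`: the permutations are grouped by `g = f ∘ σ`,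
  -- and the product of sums is expanded.
  rw [h1, ← sum_fiberwise_of_maps_to h2, prod_univ_sum, coeff_sum, mul_sum]
  refine sum_congr rfl fun g _ => ?_
  have h3 : ∏ i, (C (A i (g i)) * X (g i) : MvPolynomial ℕ R) =
      monomial (∑ i, Finsupp.single (g i) 1) (∏ i, A i (g i)) := by
    rw [monomial_sum_prod]
    simp [C_mul_X_eq_monomial]
  rw [h3, coeff_monomial, sum_congr rfl (g := fun _ => ∏ i, A i (g i)), sum_const,
    card_perm_comp_eq S f g hf]
  · split_ifs <;> simp
  · intro σ hσ
    rw [(mem_filter.1 hσ).2]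

/-! ### Row forms and exponent vectors -/

/-- The linear form of a row of block `u`, the variable `X v` standing for a column of block `v`. -/
noncomputable def rowForm {R : Type*} [CommRing R] {t : ℕ} (a : Fin (t + 1) → R) (u : ℕ) :
    MvPolynomial ℕ R :=
  ∑ i : Fin (t + 1), C (a i) * X (u + i)

/-- The product of the linear forms of all rows of the blocks `0, ..., n - 1`. -/
noncomputable def rowProduct {R : Type*} [CommRing R] {t : ℕ} (k n : ℕ) (a : Fin (t + 1) → R) :
    MvPolynomial ℕ R :=
  ∏ u ∈ range n, rowForm a u ^ k

/-- The multiplicities of `α` as an exponent vector. -/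
noncomputable def exponent {k r t : ℕ} (α : G k r t) : ℕ →₀ ℕ :=
  ∑ i : Fin t, Finsupp.single (i : ℕ) (mult α i)

/-- The exponent vector with `n` entries `k` followed by the multiplicities of `α`. -/
noncomputable def targetExponent {k r t : ℕ} : ℕ → G k r t → (ℕ →₀ ℕ)
  | 0, α => exponent α
  | n + 1, α => Finsupp.single 0 k + (targetExponent n α).mapDomain Nat.succ

theorem shift_apply_zero (e : ℕ →₀ ℕ) : e.mapDomain Nat.succ 0 = 0 :=
  Finsupp.mapDomain_of_notMem_range _ _ (by simp)

theorem shift_apply_succ (e : ℕ →₀ ℕ) (v : ℕ) : e.mapDomain Nat.succ (v + 1) = e v :=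
  Finsupp.mapDomain_apply Nat.succ_injective _ _

theorem exponent_apply {k r t : ℕ} (α : G k r t) (v : ℕ) :
    exponent α v = if h : v < t then mult α ⟨v, h⟩ else 0 := by
  rw [exponent, Finsupp.finsetSum_apply]
  split_ifs with h
  · rw [sum_eq_single ⟨v, h⟩]
    · simp
    · intro i _ hi
      exact Finsupp.single_eq_of_ne fun h' => hi (Fin.ext h'.symm)
    · simp
  · refine sum_eq_zero fun i _ => Finsupp.single_eq_of_ne ?_
    have := i.2
    omega

theorem exponent_apply_fin {k r t : ℕ} (α : G k r t) (i : Fin t) :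
    exponent α i = mult α i := by
  rw [exponent_apply, dif_pos i.2]

theorem exponent_apply_of_le {k r t : ℕ} (α : G k r t) {v : ℕ} (h : t ≤ v) :
    exponent α v = 0 := by
  rw [exponent_apply, dif_neg (by omega)]

theorem exponent_injective {k r t : ℕ} :
    Function.Injective (exponent : G k r t → (ℕ →₀ ℕ)) := by
  intro α β h
  refine Subtype.ext (funext fun i => Fin.ext ?_)
  have := DFunLike.congr_fun h (i : ℕ)
  rwa [exponent_apply_fin, exponent_apply_fin] at this

theorem mult_le {k r t : ℕ} (α : G k r t) (i : Fin t) : mult α i ≤ k :=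
  Nat.lt_succ_iff.1 (α.1 i).2

theorem exponent_le {k r t : ℕ} (α : G k r t) (v : ℕ) : exponent α v ≤ k := by
  rw [exponent_apply]
  split_ifs
  · exact mult_le _ _
  · exact Nat.zero_le _

theorem targetExponent_apply {k r t : ℕ} (n : ℕ) (α : G k r t) (v : ℕ) :
    targetExponent n α v = if v < n then k else exponent α (v - n) := by
  induction n generalizing v with
  | zero => simp [targetExponent]
  | succ n ih =>
    rw [targetExponent, Finsupp.add_apply]
    cases v with
    | zero => simp [shift_apply_zero]
    | succ v =>
      rw [shift_apply_succ, ih]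
      simp

theorem targetExponent_le {k r t : ℕ} (n : ℕ) (α : G k r t) (v : ℕ) :
    targetExponent n α v ≤ k := by
  rw [targetExponent_apply]
  split_ifs
  · exact le_rfl
  · exact exponent_le _ _

theorem degree_exponent {k r t : ℕ} (α : G k r t) : (exponent α).degree = r := by
  rw [exponent, map_sum]
  simpa [mult] using α.2

/-! ### The transfer recursion -/

/-- The coefficients of `y^β L_0^k`, where `L_0` is the linear form of the first rows. -/
theorem coeff_exponent_add {R : Type*} [CommRing R] {k r t : ℕ} (a : Fin (t + 1) → R)
    (β : G k r t) (u : Fin (t + 1) →₀ ℕ) :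
    coeff (exponent β + u.mapDomain Fin.val) (monomial (exponent β) 1 * rowForm a 0 ^ k) =
      if ∑ i, u i = k then (Nat.multinomial univ u : R) * ∏ i, a i ^ u i else 0 := by
  have h : rowForm a 0 = rename Fin.val (∑ i, a i • X i : MvPolynomial (Fin (t + 1)) R) := by
    simp [rowForm, smul_eq_C_mul]
  rw [coeff_monomial_mul, one_mul, h, ← map_pow, coeff_rename_mapDomain _ Fin.val_injective,
    coeff_linearCombination_X_pow_of_fintype, Finsupp.sum_fintype _ _ (fun _ => rfl),
    Finsupp.prod_fintype _ _ (fun _ => pow_zero _),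
    Finsupp.multinomial_eq_of_support_subset (subset_univ _)]

theorem exists_of_coeff_ne_zero {R : Type*} [CommRing R] {k r t : ℕ} (a : Fin (t + 1) → R)
    (β : G k r t) {d : ℕ →₀ ℕ}
    (hd : coeff d (monomial (exponent β) 1 * rowForm a 0 ^ k) ≠ 0) :
    ∃ u : Fin (t + 1) →₀ ℕ, d = exponent β + u.mapDomain Fin.val ∧ ∑ i, u i = k := by
  have h : rowForm a 0 = rename Fin.val (∑ i, a i • X i : MvPolynomial (Fin (t + 1)) R) := by
    simp [rowForm, smul_eq_C_mul]
  have h1 := hd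
  rw [coeff_monomial_mul', one_mul] at h1
  split_ifs at h1 with hle
  · rw [h, ← map_pow] at h1
    obtain ⟨u, hu, -⟩ := coeff_rename_ne_zero _ _ _ h1
    have hd' : d = exponent β + u.mapDomain Fin.val := by
      rw [hu, add_tsub_cancel_of_le hle]
    refine ⟨u, hd', ?_⟩
    rw [hd', coeff_exponent_add] at hd
    by_contra hne
    exact hd (if_neg hne)
  · exact absurd rfl h1

/-- The factor `rename Nat.succ Q` does not involve `X_0`, so `P` must supply all of `X_0^k`; only
the remaining exponent `e` is split between the factors. -/
theorem coeff_mul_rename_succ {R : Type*} [CommRing R] (P Q : MvPolynomial ℕ R) (k : ℕ)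
    (e : ℕ →₀ ℕ) :
    coeff (Finsupp.single 0 k + e.mapDomain Nat.succ) (P * rename Nat.succ Q) =
      ∑ x ∈ antidiagonal e,
        coeff (Finsupp.single 0 k + x.1.mapDomain Nat.succ) P * coeff x.2 Q := by
  rw [coeff_mul]
  symm
  refine sum_of_injOn (fun x => (Finsupp.single 0 k + x.1.mapDomain Nat.succ,
    x.2.mapDomain Nat.succ)) ?_ ?_ ?_ ?_
  · rintro ⟨x, y⟩ _ ⟨x', y'⟩ _ h
    simp only [Prod.mk.injEq, add_right_inj] at h
    exact Prod.ext (Finsupp.mapDomain_injective Nat.succ_injective h.1)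
      (Finsupp.mapDomain_injective Nat.succ_injective h.2)
  · rintro ⟨x, y⟩ h
    simp only [mem_coe, HasAntidiagonal.mem_antidiagonal] at h ⊢
    rw [← h, Finsupp.mapDomain_add, add_assoc]
  · rintro ⟨x, y⟩ h hxy
    rw [HasAntidiagonal.mem_antidiagonal] at h
    simp only at h ⊢
    by_contra hne
    obtain ⟨u, rfl, -⟩ := coeff_rename_ne_zero _ _ _ (right_ne_zero_of_mul hne)
    have hle : u ≤ e := fun v => by
      have := DFunLike.congr_fun h (v + 1)
      simp only [Finsupp.add_apply, shift_apply_succ] at this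
      simp at this
      omega
    refine hxy ⟨(e - u, u), by simpa using tsub_add_cancel_of_le hle, ?_⟩
    refine Prod.ext (add_right_cancel (b := u.mapDomain Nat.succ) ?_) rfl
    simp only
    rw [h, add_assoc, ← Finsupp.mapDomain_add, tsub_add_cancel_of_le hle]
  · rintro ⟨x, y⟩ _
    simp only [coeff_rename_mapDomain _ Nat.succ_injective]

/-- The coefficient that is equal to the entry of the `n`-th power of the matrix `Π`, up to a
diagonal conjugation and a constant factor. -/
noncomputable def transfer {R : Type*} [CommRing R] {k r t : ℕ} (a : Fin (t + 1) → R) (n : ℕ)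
    (α β : G k r t) : R :=
  coeff (targetExponent n α) (monomial (exponent β) 1 * rowProduct k n a)

theorem transfer_zero {R : Type*} [CommRing R] {k r t : ℕ} (a : Fin (t + 1) → R)
    (α β : G k r t) : transfer a 0 α β = if α = β then 1 else 0 := by
  simp only [transfer, targetExponent, rowProduct, range_zero, prod_empty, mul_one,
    coeff_monomial, exponent_injective.eq_iff, eq_comm]

theorem rowProduct_succ {R : Type*} [CommRing R] {t : ℕ} (k n : ℕ) (a : Fin (t + 1) → R) :
    rowProduct k (n + 1) a = rowForm a 0 ^ k * rename Nat.succ (rowProduct k n a) := by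
  rw [rowProduct, prod_range_succ', mul_comm, rowProduct, map_prod]
  congr 1
  refine prod_congr rfl fun u _ => ?_
  rw [map_pow]
  congr 1
  simp only [rowForm, map_sum, map_mul, rename_C, rename_X]
  refine sum_congr rfl fun i _ => ?_
  congr 2
  omega

theorem transfer_succ {R : Type*} [CommRing R] {k r t : ℕ} (a : Fin (t + 1) → R) (n : ℕ)
    (α β : G k r t) :
    transfer a (n + 1) α β = ∑ γ, transfer a n α γ * transfer a 1 γ β := by
  have h1 : ∀ γ, transfer a 1 γ β = coeff (Finsupp.single 0 k + (exponent γ).mapDomain Nat.succ)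
      (monomial (exponent β) 1 * rowForm a 0 ^ k) := by
    intro γ
    simp [transfer, targetExponent, rowProduct]
  have h2 : ∀ γ, transfer a n α γ * transfer a 1 γ β = if exponent γ ≤ targetExponent n α then
      coeff (Finsupp.single 0 k + (exponent γ).mapDomain Nat.succ)
        (monomial (exponent β) 1 * rowForm a 0 ^ k) *
          coeff (targetExponent n α - exponent γ) (rowProduct k n a) else 0 := by
    intro γ
    rw [h1, transfer, coeff_monomial_mul', one_mul]
    split_ifs
    · rw [mul_comm]
    · rw [zero_mul]
  simp only [h2]
  rw [transfer, rowProduct_succ, ← mul_assoc, targetExponent, coeff_mul_rename_succ,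
    ← sum_filter]
  symm
  -- The splittings of the target exponent are matched with vectors `γ`; every splitting with a
  -- nonzero term must be shown to start with an element of `G k r t`.
  refine sum_of_injOn (fun γ => (exponent γ, targetExponent n α - exponent γ)) ?_ ?_ ?_ ?_
  · intro γ _ γ' _ h
    exact exponent_injective (Prod.ext_iff.1 h).1
  · intro γ h
    simp only [coe_filter, mem_univ, true_and, Set.mem_ofPred_eq] at h
    simp only [mem_coe, HasAntidiagonal.mem_antidiagonal]
    exact add_tsub_cancel_of_le h
  · rintro ⟨x, y⟩ h hxy
    rw [HasAntidiagonal.mem_antidiagonal] at h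
    simp only at h ⊢
    by_contra hne
    obtain ⟨u, hu, huk⟩ := exists_of_coeff_ne_zero a β (left_ne_zero_of_mul hne)
    -- The bound `k` on multiplicities comes from the target, whose entries are all at most `k`.
    have hxk : ∀ v, x v < k + 1 := fun v => by
      have h3 := DFunLike.congr_fun h v
      have h4 := targetExponent_le n α v
      rw [Finsupp.add_apply] at h3
      omega
    have hx0 : ∀ v, t ≤ v → x v = 0 := fun v hv => by
      have h3 := DFunLike.congr_fun hu (v + 1)
      rw [Finsupp.add_apply, Finsupp.add_apply, shift_apply_succ, exponent_apply_of_le _ (by omega),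
        Finsupp.mapDomain_of_notMem_range, Finsupp.single_eq_of_ne (by simp)] at h3
      · simpa using h3
      · rintro ⟨i, hi⟩
        have := i.2
        omega
    have hxs : x = ∑ i : Fin t, Finsupp.single (i : ℕ) (x i) := by
      ext v
      rw [Finsupp.finsetSum_apply]
      by_cases hv : v < t
      · rw [sum_eq_single ⟨v, hv⟩]
        · simp
        · intro i _ hi
          exact Finsupp.single_eq_of_ne fun h' => hi (Fin.ext h'.symm)
        · simp
      · rw [hx0 v (by omega)]
        refine (sum_eq_zero fun i _ => Finsupp.single_eq_of_ne ?_).symm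
        have := i.2
        omega
    -- Degrees in `hu`: `k + deg x = r + k`.
    have hdeg : x.degree = r := by
      have h3 := congrArg Finsupp.degree hu
      rw [map_add, map_add, Finsupp.degree_single, degree_exponent, Finsupp.degree_mapDomain,
        Finsupp.degree_mapDomain, Finsupp.degree_eq_sum u, huk] at h3
      omega
    have hsum : ∑ i : Fin t, x i = r := by
      rw [← hdeg]
      conv_rhs => rw [hxs, map_sum]
      simp
    let γ : G k r t := ⟨fun i => ⟨x i, hxk i⟩, hsum⟩
    have hγ : exponent γ = x := hxs.symm
    refine hxy ⟨γ, ?_, ?_⟩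
    · simp only [coe_filter, mem_univ, true_and, Set.mem_ofPred_eq, hγ]
      exact le_iff_exists_add.2 ⟨y, h.symm⟩
    · simp only [hγ, ← h, add_tsub_cancel_left]
  · intro γ _
    rfl

/-! ### The matrix `Π` and its powers as coefficients -/

theorem targetExponent_one {k r t : ℕ} (α : G k r t) :
    targetExponent 1 α = Finsupp.single 0 k + (exponent α).mapDomain Nat.succ := rfl

theorem targetExponent_one_zero {k r t : ℕ} (α : G k r t) : targetExponent 1 α 0 = k := by
  simp [targetExponent_apply]

theorem targetExponent_one_succ {k r t : ℕ} (α : G k r t) (v : ℕ) :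
    targetExponent 1 α (v + 1) = exponent α v := by
  simp [targetExponent_apply]

/-- If `β` divides `(k, α)`, the quotient exponent vector is supported on the variables of the
linear form of the first rows and has degree `k`. -/
theorem exists_residual {k r t : ℕ} {α β : G k r t} (h : exponent β ≤ targetExponent 1 α) :
    ∃ u : Fin (t + 1) →₀ ℕ, targetExponent 1 α = exponent β + u.mapDomain Fin.val ∧
      (∑ i, u i = k) ∧ ∀ i : Fin (t + 1), u i = targetExponent 1 α i - exponent β i := by
  let u : Fin (t + 1) →₀ ℕ :=
    Finsupp.equivFunOnFinite.symm fun i => targetExponent 1 α i - exponent β i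
  have hu : targetExponent 1 α = exponent β + u.mapDomain Fin.val := by
    ext v
    rw [Finsupp.add_apply]
    by_cases hv : v < t + 1
    · have h1 : u.mapDomain Fin.val v = u ⟨v, hv⟩ :=
        Finsupp.mapDomain_apply Fin.val_injective u ⟨v, hv⟩
      have h2 := h v
      rw [h1]
      change _ = _ + (targetExponent 1 α v - exponent β v)
      omega
    · rw [Finsupp.mapDomain_of_notMem_range]
      · obtain ⟨w, rfl⟩ : ∃ w, v = w + 1 := ⟨v - 1, by omega⟩
        rw [targetExponent_one_succ, exponent_apply_of_le _ (by omega),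
          exponent_apply_of_le _ (by omega), add_zero]
      · rintro ⟨i, hi⟩
        have := i.2
        omega
  refine ⟨u, hu, ?_, fun i => rfl⟩
  have h3 := congrArg Finsupp.degree hu
  rw [targetExponent_one, map_add, map_add, Finsupp.degree_single, degree_exponent,
    Finsupp.degree_mapDomain, Finsupp.degree_mapDomain, degree_exponent,
    Finsupp.degree_eq_sum u] at h3
  omega

/-- The entries of the matrix `Π` as coefficients of `y^β L_0^k`, where `L_0` is the linear form
of the first rows. -/
theorem piEntry_eq_transfer {R : Type*} [CommRing R] {k r t : ℕ} (a : Fin (t + 1) → R)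
    (α β : G k r t) :
    piEntry k r t a α β * ((∏ i, (mult β i)! : ℕ) : R) =
      (k ! : R) * ((∏ i, (mult α i)! : ℕ) : R) * transfer a 1 α β := by
  have hT : transfer a 1 α β = coeff (targetExponent 1 α)
      (monomial (exponent β) 1 * rowForm a 0 ^ k) := by
    simp [transfer, rowProduct]
  by_cases h : exponent β ≤ targetExponent 1 α
  · obtain ⟨u, hu, huk, hui⟩ := exists_residual h
    rw [hT, hu, coeff_exponent_add, if_pos huk]
    have hspec := Nat.multinomial_spec univ u
    rw [huk] at hspec
    have hpos : 0 < ∏ i, (u i)! := prod_pos fun i _ => Nat.factorial_pos _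
    cases t with
    | zero =>
      have h0 : u 0 = k := by simpa using huk
      simp [piEntry, h0]
    | succ s =>
      have hu0 : u 0 = k - mult β 0 := by
        rw [hui]
        simp only [Fin.val_zero, targetExponent_one_zero]
        rw [← exponent_apply_fin β 0, Fin.val_zero]
      have hus : ∀ i : Fin s, u i.castSucc.succ = mult α i.castSucc - mult β i.succ := by
        intro i
        rw [hui, ← exponent_apply_fin, ← exponent_apply_fin]
        simp only [Fin.val_succ, Fin.val_castSucc, targetExponent_one_succ]
      have hul : u (Fin.last s).succ = mult α (Fin.last s) := by
        rw [hui, ← exponent_apply_fin]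
        simp only [Fin.val_succ, Fin.val_last, targetExponent_one_succ,
          exponent_apply_of_le β le_rfl, Nat.sub_zero]
      have hle : ∀ i : Fin s, mult β i.succ ≤ mult α i.castSucc := by
        intro i
        have := h ((i : ℕ) + 1)
        rw [targetExponent_one_succ] at this
        rwa [← exponent_apply_fin, ← exponent_apply_fin]
      have hβ0 : mult β 0 ≤ k := mult_le β 0
      -- The condition on `q` is the degree condition `∑ u_i = k`, because `u = (k - m_β(1), p_1,
      -- ..., p_{t-1}, l_t)`.
      have hq : mult β 0 = mult α (Fin.last s) +
          ∑ i : Fin s, (mult α i.castSucc - mult β i.succ) := by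
        rw [Fin.sum_univ_succ, Fin.sum_univ_castSucc, hu0, Fin.succ_last, ← Fin.succ_last, hul,
          sum_congr rfl fun i _ => hus i] at huk
        omega
      have hcond : (∀ i : Fin s, mult β i.succ ≤ mult α i.castSucc) ∧
          mult β 0 = mult α (Fin.last s) +
            ∑ i : Fin s, (mult α i.castSucc - mult β i.succ) ∧
          mult α (Fin.last s) + ∑ i : Fin s, (mult α i.castSucc - mult β i.succ) ≤ k :=
        ⟨hle, hq, hq ▸ hβ0⟩
      have hpi : piEntry k r (s + 1) a α β = (k ! : R) * (k.choose (mult β 0) : R) *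
          (∏ i : Fin s, ((mult α i.castSucc).choose (mult α i.castSucc - mult β i.succ) : R)) *
          a 0 ^ (k - mult β 0) *
          (∏ i : Fin s, a i.castSucc.succ ^ (mult α i.castSucc - mult β i.succ)) *
          a (Fin.last (s + 1)) ^ mult α (Fin.last s) := by
        simp only [piEntry]
        rw [if_pos hcond, ← hq]
      have hprod : ∏ i, a i ^ u i = a 0 ^ (k - mult β 0) *
          ((∏ i : Fin s, a i.castSucc.succ ^ (mult α i.castSucc - mult β i.succ)) *
          a (Fin.last (s + 1)) ^ mult α (Fin.last s)) := by
        rw [Fin.prod_univ_succ, Fin.prod_univ_castSucc, hu0, hul, Fin.succ_last]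
        simp only [hus]
      have hnat : k ! * k.choose (mult β 0) *
          (∏ i : Fin s, (mult α i.castSucc).choose (mult α i.castSucc - mult β i.succ)) *
            (∏ i, (mult β i)!) = k ! * (∏ i, (mult α i)!) * Nat.multinomial univ u := by
        have hfact : (∏ i : Fin s, (mult α i.castSucc).choose
            (mult α i.castSucc - mult β i.succ)) *
              (∏ i : Fin s, (mult α i.castSucc - mult β i.succ)!) *
              (∏ i : Fin s, (mult β i.succ)!) = ∏ i : Fin s, (mult α i.castSucc)! := by
          rw [← prod_mul_distrib, ← prod_mul_distrib]
          refine prod_congr rfl fun i _ => ?_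
          have := Nat.choose_mul_factorial_mul_factorial
            (Nat.sub_le (mult α i.castSucc) (mult β i.succ))
          rwa [Nat.sub_sub_self (hle i)] at this
        have hk0 := Nat.choose_mul_factorial_mul_factorial hβ0
        have huf : ∏ i, (u i)! = (k - mult β 0)! *
            ((∏ i : Fin s, (mult α i.castSucc - mult β i.succ)!) * (mult α (Fin.last s))!) := by
          rw [Fin.prod_univ_succ, Fin.prod_univ_castSucc, hu0, hul]
          simp only [hus]
        -- Multiplying by `∏ u_i!` turns the multinomial coefficient into `k!`, which avoids
        -- division.
        refine Nat.eq_of_mul_eq_mul_left hpos ?_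
        have hr : (∏ i, (u i)!) * (k ! * (∏ i, (mult α i)!) * Nat.multinomial univ u) =
            k ! * (∏ i, (mult α i)!) *
              (k.choose (mult β 0) * (mult β 0)! * (k - mult β 0)!) := by
          rw [mul_left_comm, hspec, hk0]
        rw [hr, huf, Fin.prod_univ_succ (fun i => (mult β i)!),
          Fin.prod_univ_castSucc (fun i => (mult α i)!), ← hfact]
        ring
      rw [hpi, hprod]
      have := congrArg (Nat.cast : ℕ → R) hnat
      push_cast at this ⊢
      linear_combination (a 0 ^ (k - mult β 0) *
          ((∏ i : Fin s, a i.castSucc.succ ^ (mult α i.castSucc - mult β i.succ)) *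
          a (Fin.last (s + 1)) ^ mult α (Fin.last s))) * this
  -- If `X^β` does not divide the target, some `m_β(i+1)` exceeds `l_i`, so the entry of `Π` is zero
  -- as well. For `t = 0` this case cannot occur.
  · rw [hT, coeff_monomial_mul', if_neg h, mul_zero]
    cases t with
    | zero =>
      refine absurd (fun v => ?_) h
      rw [exponent_apply_of_le _ (Nat.zero_le v)]
      exact Nat.zero_le _
    | succ s =>
      simp only [piEntry]
      rw [if_neg, zero_mul]
      rintro ⟨h1, -, -⟩
      refine h fun v => ?_
      cases v with
      | zero =>
        rw [targetExponent_one_zero]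
        exact exponent_le _ _
      | succ v =>
        rw [targetExponent_one_succ]
        by_cases hv : v < s
        · have := h1 ⟨v, hv⟩
          rwa [← exponent_apply_fin, ← exponent_apply_fin] at this
        · rw [exponent_apply_of_le β (by omega)]
          exact Nat.zero_le _

/-- The entries of the powers of the matrix `Π` as coefficients. -/
theorem piMatrix_pow_eq_transfer {R : Type*} [CommRing R] {k r t : ℕ} (a : Fin (t + 1) → R)
    (n : ℕ) (α β : G k r t) :
    (piMatrix k r t a ^ n) α β * ((∏ i, (mult β i)! : ℕ) : R) =
      (k ! : R) ^ n * ((∏ i, (mult α i)! : ℕ) : R) * transfer a n α β := by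
  induction n generalizing β with
  | zero =>
    rw [pow_zero, pow_zero, transfer_zero, Matrix.one_apply]
    split_ifs with h
    · rw [h]
      ring
    · ring
  | succ n ih =>
    rw [pow_succ, Matrix.mul_apply, sum_mul, transfer_succ, mul_sum]
    refine sum_congr rfl fun γ _ => ?_
    have h1 := ih γ
    have h2 := piEntry_eq_transfer a γ β
    rw [piMatrix, Matrix.of_apply, ← piMatrix]
    linear_combination (piMatrix k r t a ^ n) α γ * h2 + (k ! : R) * transfer a 1 γ β * h1

/-! ### The Toeplitz rows and the selected columns -/

/-- The entry of `∑ a_i T^{(i)}` at the position `(u, v)`. -/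
def rowCoeff {R : Type*} [CommRing R] {t : ℕ} (a : Fin (t + 1) → R) (u v : ℕ) : R :=
  ∑ i : Fin (t + 1), if v = u + i then a i else 0

theorem toeplitzKronecker_apply {R : Type*} [CommRing R] {t : ℕ} (N k : ℕ) (a : Fin (t + 1) → R)
    (i j : Fin (N * k)) :
    toeplitzKronecker N k a i j = rowCoeff a ((i : ℕ) / k) ((j : ℕ) / k) := by
  simp only [toeplitzKronecker, Matrix.reindex_apply, Matrix.submatrix_apply,
    Matrix.kroneckerMap_apply, J, Matrix.of_apply, mul_one, Matrix.sum_apply, Matrix.smul_apply,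
    T, rowCoeff, smul_eq_mul, finProdFinEquiv_symm_apply]
  refine sum_congr rfl fun x _ => ?_
  rw [mul_ite, mul_one, mul_zero]
  refine if_congr ?_ rfl rfl
  rw [← Fin.coe_divNat, ← Fin.coe_divNat]
  omega

/-- For `u < n` all indices `u + i` stay below `n + t`, so the finite order of the matrix cuts off
no term. -/
theorem sum_rowCoeff {R : Type*} [CommRing R] {n t u : ℕ} (a : Fin (t + 1) → R) (hu : u < n) :
    ∑ v ∈ range (n + t), C (rowCoeff a u v) * X v = rowForm a u := by
  simp only [rowCoeff, rowForm, map_sum, sum_mul]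
  rw [sum_comm]
  refine sum_congr rfl fun i _ => ?_
  rw [sum_eq_single (u + (i : ℕ))]
  · simp
  · intro v _ hv
    simp [hv]
  · intro h
    have := i.2
    exact absurd (mem_range.2 (by omega)) h

theorem prod_rowForm {R : Type*} [CommRing R] {t : ℕ} (k n : ℕ) (a : Fin (t + 1) → R) :
    ∏ i : Fin (n * k), rowForm a ((i : ℕ) / k) = rowProduct k n a := by
  rw [rowProduct, ← Fin.prod_univ_eq_prod_range (fun u => rowForm a u ^ k) n,
    Fintype.prod_equiv finProdFinEquiv.symm (fun i : Fin (n * k) => rowForm a ((i : ℕ) / k))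
      (fun p : Fin n × Fin k => rowForm a (p.1 : ℕ)) (fun i => by simp [Fin.coe_divNat]),
    Fintype.prod_prod_type]
  simp

theorem sum_map_vec {M : Type*} [AddCommMonoid M] {t : ℕ} (l : Fin t → ℕ) (g : ℕ → M) :
    ((vec l).map g).sum = ∑ i, l i • g ((i : ℕ) + 1) := by
  rw [vec, List.map_flatMap, List.flatMap_def, List.sum_flatten, List.map_map, Fin.sum_univ_def]
  simp [Function.comp_def]

theorem sum_map_range' (k m d : ℕ) :
    ((List.range' (m * k + 1) (d * k)).map fun x => Finsupp.single ((x - 1) / k) 1).sum =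
      (∑ u ∈ range d, Finsupp.single (m + u) k : ℕ →₀ ℕ) := by
  induction d with
  | zero => simp
  | succ d ih =>
    have h : List.range' (m * k + 1) ((d + 1) * k) = List.range' (m * k + 1) (d * k) ++
        List.range' ((m + d) * k + 1) k := by
      rw [Nat.add_mul d 1 k, one_mul, ← List.range'_append_1]
      congr 2
      ring
    have h2 : ((List.range' ((m + d) * k + 1) k).map fun x =>
        (Finsupp.single ((x - 1) / k) 1 : ℕ →₀ ℕ)) =
        List.replicate k (Finsupp.single (m + d) 1) := by
      rw [List.eq_replicate_iff]
      refine ⟨by simp, fun b hb => ?_⟩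
      obtain ⟨x, hx, rfl⟩ := List.mem_map.1 hb
      rw [List.mem_range'_1] at hx
      congr 1
      refine Nat.div_eq_of_lt_le (by omega) ?_
      rw [Nat.add_mul (m + d) 1 k]
      omega
    rw [h, List.map_append, List.sum_append, ih, h2, sum_range_succ]
    simp

theorem targetExponent_eq_sum {k r t : ℕ} (n : ℕ) (α : G k r t) :
    targetExponent n α = ∑ u ∈ range n, Finsupp.single u k +
      ∑ i : Fin t, Finsupp.single (n + i) (mult α i) := by
  induction n with
  | zero => simp [targetExponent, exponent]
  | succ n ih =>
    rw [targetExponent, ih, sum_range_succ', Finsupp.mapDomain_add, Finsupp.mapDomain_finsetSum,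
      Finsupp.mapDomain_finsetSum, ← add_assoc, add_comm (Finsupp.single 0 k)]
    simp only [Finsupp.mapDomain_single, Nat.succ_eq_add_one, Nat.add_right_comm n]

theorem exponent_pad {k r m t : ℕ} (h : m ≤ t) (β : G k r m) :
    exponent (pad h β) = exponent β := by
  ext v
  rw [exponent_apply, exponent_apply]
  by_cases hm : v < m
  · rw [dif_pos (by omega), dif_pos hm]
    simp [mult, pad, hm]
  · rw [dif_neg hm]
    split_ifs
    · simp [mult, pad, hm]
    · rfl

theorem prod_factorial_mult_pad {k r m t : ℕ} (h : m ≤ t) (β : G k r m) :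
    ∏ i, (mult (pad h β) i)! = ∏ i, (mult β i)! := by
  obtain ⟨d, rfl⟩ := Nat.exists_eq_add_of_le h
  rw [Fin.prod_univ_add]
  simp [mult, pad]

/-- The block containing the `j`-th selected column. -/
def columnBlock {n t k r : ℕ} (hk : 1 ≤ k) (β : G k r (min n t)) (α : G k r t)
    (j : Fin (n * k)) : ℕ :=
  (columnIndex hk β α j : ℕ) / k

theorem columnBlock_mem {n t k r : ℕ} (hk : 1 ≤ k) (β : G k r (min n t)) (α : G k r t)
    (j : Fin (n * k)) : columnBlock hk β α j ∈ range (n + t) :=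
  mem_range.2 (Nat.div_lt_of_lt_mul ((columnIndex hk β α j).2.trans_eq (mul_comm _ _)))

theorem sum_single_columnBlock {n t k r : ℕ} (hk : 1 ≤ k) (β : G k r (min n t)) (α : G k r t) :
    (∑ j, Finsupp.single (columnBlock hk β α j) 1 : ℕ →₀ ℕ) =
      ∑ i : Fin (min n t), Finsupp.single (i : ℕ) (k - mult β i) +
        ∑ u ∈ range (n - min n t), Finsupp.single (min n t + u) k +
          ∑ i : Fin t, Finsupp.single (n + i) (mult α i) := by
  have h1 : (∑ j, Finsupp.single (columnBlock hk β α j) 1 : ℕ →₀ ℕ) =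
      ((columnVector β α).map fun x => Finsupp.single ((x - 1) / k) 1).sum := by
    rw [← List.sum_ofFn]
    congr 1
    refine List.ext_get (by simp [length_columnVector]) fun i hi hi' => ?_
    simp [columnBlock, columnIndex]
  -- Column `k(x+1)`, counted from `1`, is the last column of block `x`, counted from `0`.
  have hdiv : ∀ x, (k * (x + 1) - 1) / k = x := fun x => by
    refine Nat.div_eq_of_lt_le ?_ ?_
    · rw [mul_add, mul_comm x]
      omega
    · rw [mul_comm]
      have : 0 < (x + 1) * k := Nat.mul_pos x.succ_pos hk
      omega
  have hdiv' : ∀ x, (n * k + k * (x + 1) - 1) / k = n + x := fun x => by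
    rw [← hdiv (n + x)]
    congr 2
    ring
  rw [h1, columnVector, List.map_append, List.map_append, List.sum_append, List.sum_append,
    List.map_map, List.map_map, sum_map_vec, sum_map_vec, sum_map_range']
  simp only [Function.comp_apply, hdiv, hdiv', Finsupp.smul_single, smul_eq_mul, mul_one]

/-- The column list contains each block `i < m` only `k - m_β(i+1)` times; the factor `X^β` fills
these up to `k`. -/
theorem exponent_add_sum_single {n t k r : ℕ} (hk : 1 ≤ k) (β : G k r (min n t)) (α : G k r t) :
    exponent (pad (Nat.min_le_right n t) β) +
      ∑ j, Finsupp.single (columnBlock hk β α j) 1 = targetExponent n α := by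
  have h1 : ∑ u ∈ range n, Finsupp.single u k =
      (∑ u ∈ range (min n t), Finsupp.single u k +
        ∑ u ∈ range (n - min n t), Finsupp.single (min n t + u) k : ℕ →₀ ℕ) := by
    rw [← sum_range_add, Nat.add_sub_cancel' (Nat.min_le_left n t)]
  have h2 : (∑ u ∈ range (min n t), Finsupp.single u k : ℕ →₀ ℕ) =
      exponent β + ∑ i : Fin (min n t), Finsupp.single (i : ℕ) (k - mult β i) := by
    rw [← Fin.sum_univ_eq_sum_range (fun u => Finsupp.single u k), exponent,
      ← sum_add_distrib]
    refine sum_congr rfl fun i _ => ?_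
    rw [← Finsupp.single_add, Nat.add_sub_cancel' (mult_le β i)]
  rw [exponent_pad, sum_single_columnBlock, targetExponent_eq_sum, h1, h2]
  simp only [add_assoc]

theorem prod_factorial_card {n t k r : ℕ} (hk : 1 ≤ k) (β : G k r (min n t)) (α : G k r t) :
    ∏ v ∈ range (n + t), (#{j | columnBlock hk β α j = v})! =
      (∏ i, (k - mult β i)!) * k ! ^ (n - min n t) * ∏ i, (mult α i)! := by
  -- The difference is `k - m_β(v+1)` for `v < m`, `k` for `m ≤ v < n`, and a multiplicity of `α`
  -- for `n ≤ v < n + t`.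
  have hc : ∀ v, #{j | columnBlock hk β α j = v} = targetExponent n α v - exponent β v := by
    intro v
    rw [← sum_single_one_apply, ← exponent_add_sum_single hk β α, exponent_pad,
      Finsupp.add_apply, Nat.add_sub_cancel_left]
  simp only [hc]
  have hn : n = min n t + (n - min n t) := (Nat.add_sub_cancel' (Nat.min_le_left n t)).symm
  rw [prod_range_add, ← Fin.prod_univ_eq_prod_range (fun u =>
    (targetExponent n α (n + u) - exponent β (n + u))!) t]
  congr 1
  · conv_lhs => rw [show range n = range (min n t + (n - min n t)) by rw [← hn]]
    rw [prod_range_add, ← Fin.prod_univ_eq_prod_range (fun u =>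
      (targetExponent n α u - exponent β u)!) (min n t)]
    congr 1
    · refine prod_congr rfl fun i _ => ?_
      rw [exponent_apply_fin, targetExponent_apply, if_pos (by have := i.2; omega)]
    · rw [prod_congr rfl (g := fun _ => k !), prod_const, card_range]
      intro u hu
      rw [exponent_apply_of_le β (by omega), targetExponent_apply,
        if_pos (by have := mem_range.1 hu; omega), Nat.sub_zero]
  · refine prod_congr rfl fun i _ => ?_
    rw [exponent_apply_of_le β (by omega), targetExponent_apply, if_neg (by omega),
      Nat.add_sub_cancel_left, exponent_apply_fin, Nat.sub_zero]

/-! ### The permanent formula -/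

theorem columnSubmatrix_eq {R : Type*} [CommRing R] {n t k r : ℕ} (hk : 1 ≤ k)
    (a : Fin (t + 1) → R) (β : G k r (min n t)) (α : G k r t) :
    columnSubmatrix hk a β α =
      Matrix.of fun (i : Fin (n * k)) j => rowCoeff a ((i : ℕ) / k) (columnBlock hk β α j) := by
  ext i j
  rw [columnSubmatrix, Matrix.submatrix_apply, toeplitzKronecker_apply]
  rfl

theorem permanent_columnSubmatrix {R : Type*} [CommRing R] {n t k r : ℕ} (hk : 1 ≤ k)
    (a : Fin (t + 1) → R) (β : G k r (min n t)) (α : G k r t) :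
    (columnSubmatrix hk a β α).permanent =
      (((∏ i, (k - mult β i)!) * k ! ^ (n - min n t) * ∏ i, (mult α i)! : ℕ) : R) *
        transfer a n α (pad (Nat.min_le_right n t) β) := by
  have h1 : ∏ i : Fin (n * k), ∑ v ∈ range (n + t), C (rowCoeff a ((i : ℕ) / k) v) * X v =
      rowProduct k n a := by
    rw [← prod_rowForm]
    refine prod_congr rfl fun i _ => sum_rowCoeff a ?_
    exact Nat.div_lt_of_lt_mul (i.2.trans_eq (mul_comm _ _))
  rw [columnSubmatrix_eq, permanent_eq_coeff (range (n + t))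
    (fun (i : Fin (n * k)) v => rowCoeff a ((i : ℕ) / k) v) (columnBlock hk β α)
    (columnBlock_mem hk β α), prod_factorial_card, h1, transfer,
    ← exponent_add_sum_single hk β α, coeff_monomial_mul, one_mul]

/-- The `m` identities `binom(k, b) b! (k - b)! = k!` complete `k!^(n-m)` to the `k!^n` of
`piMatrix_pow_eq_transfer`. The factorials of `β` remain on both sides because they may be zero
divisors in `R`. -/
theorem permanent_mul_prod_factorial {R : Type*} [CommRing R] {n t k r : ℕ} (hk : 1 ≤ k)
    (a : Fin (t + 1) → R) (β : G k r (min n t)) (α : G k r t) :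
    (∏ i, (k.choose (mult β i) : R)) * (columnSubmatrix hk a β α).permanent *
        ((∏ i, (mult β i)! : ℕ) : R) =
      (piMatrix k r t a ^ n) α (pad (Nat.min_le_right n t) β) *
        ((∏ i, (mult β i)! : ℕ) : R) := by
  have hnat : (∏ i, k.choose (mult β i)) *
      ((∏ i, (k - mult β i)!) * k ! ^ (n - min n t) * ∏ i, (mult α i)!) *
        (∏ i, (mult β i)!) = k ! ^ n * ∏ i, (mult α i)! := by
    have h1 : (∏ i, k.choose (mult β i)) * (∏ i, (mult β i)!) * (∏ i, (k - mult β i)!) =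
        k ! ^ min n t := by
      rw [← prod_mul_distrib, ← prod_mul_distrib,
        prod_congr rfl fun i _ => Nat.choose_mul_factorial_mul_factorial (mult_le β i)]
      simp
    rw [← pow_mul_pow_sub (k !) (Nat.min_le_left n t), ← h1]
    ring
  have h2 := piMatrix_pow_eq_transfer a n α (pad (Nat.min_le_right n t) β)
  rw [prod_factorial_mult_pad] at h2
  rw [h2, permanent_columnSubmatrix]
  have := congrArg (Nat.cast : ℕ → R) hnat
  push_cast at this ⊢
  linear_combination transfer a n α (pad (Nat.min_le_right n t) β) * this

/-! ### Generic cancellation and specialisation -/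

theorem map_rowCoeff {R S : Type*} [CommRing R] [CommRing S] (F : R →+* S) {t : ℕ}
    (a : Fin (t + 1) → R) (u v : ℕ) :
    F (rowCoeff a u v) = rowCoeff (fun i => F (a i)) u v := by
  simp [rowCoeff, apply_ite F]

theorem map_permanent_columnSubmatrix {R S : Type*} [CommRing R] [CommRing S] (F : R →+* S)
    {n t k r : ℕ} (hk : 1 ≤ k) (a : Fin (t + 1) → R) (β : G k r (min n t)) (α : G k r t) :
    F (columnSubmatrix hk a β α).permanent =
      (columnSubmatrix hk (fun i => F (a i)) β α).permanent := by
  simp [columnSubmatrix_eq, Matrix.permanent, map_rowCoeff]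

theorem map_piMatrix {R S : Type*} [CommRing R] [CommRing S] (F : R →+* S) {t : ℕ} (k r : ℕ)
    (a : Fin (t + 1) → R) :
    F.mapMatrix (piMatrix k r t a) = piMatrix k r t fun i => F (a i) := by
  ext α β
  cases t with
  | zero => simp [piMatrix, piEntry]
  | succ s =>
    simp only [piMatrix, piEntry, RingHom.mapMatrix_apply, Matrix.map_apply, Matrix.of_apply]
    split_ifs
    · simp
    · simp

theorem map_piMatrix_pow_apply {R S : Type*} [CommRing R] [CommRing S] (F : R →+* S) {t : ℕ}
    (k r n : ℕ) (a : Fin (t + 1) → R) (α β : G k r t) :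
    F ((piMatrix k r t a ^ n) α β) = (piMatrix k r t (fun i => F (a i)) ^ n) α β := by
  rw [← map_piMatrix, ← map_pow]
  rfl

/-- Over `ℤ[X_0, ..., X_t]`, a domain of characteristic zero, the factorials cancel. The generic
permanent is thus the quotient whose existence the theorem asserts. -/
theorem prod_choose_mul_permanent_X {n t k r : ℕ} (hk : 1 ≤ k) (β : G k r (min n t))
    (α : G k r t) :
    (∏ i, (k.choose (mult β i) : MvPolynomial (Fin (t + 1)) ℤ)) *
        (columnSubmatrix hk (X : Fin (t + 1) → MvPolynomial (Fin (t + 1)) ℤ) β α).permanent =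
      (piMatrix k r t (X : Fin (t + 1) → MvPolynomial (Fin (t + 1)) ℤ) ^ n)
        α (pad (Nat.min_le_right n t) β) := by
  refine mul_right_cancel₀ (b := ((∏ i, (mult β i)! : ℕ) : MvPolynomial (Fin (t + 1)) ℤ)) ?_
    (permanent_mul_prod_factorial hk _ β α)
  exact Nat.cast_ne_zero.2 (prod_ne_zero_iff.2 fun i _ => Nat.factorial_ne_zero _)

theorem prod_choose_ne_zero {t k r m : ℕ} (β : G k r m) :
    (∏ i, (k.choose (mult β i) : MvPolynomial (Fin (t + 1)) ℤ)) ≠ 0 :=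
  prod_ne_zero_iff.2 fun i _ => Nat.cast_ne_zero.2 (Nat.choose_pos (mult_le β i)).ne'

theorem prod_choose_mul_permanent {R : Type*} [CommRing R] {n t k r : ℕ} (hk : 1 ≤ k)
    (a : Fin (t + 1) → R) (β : G k r (min n t)) (α : G k r t) :
    (∏ i, (k.choose (mult β i) : R)) * (columnSubmatrix hk a β α).permanent =
      (piMatrix k r t a ^ n) α (pad (Nat.min_le_right n t) β) := by
  have h := congrArg (aeval a : MvPolynomial (Fin (t + 1)) ℤ →ₐ[ℤ] R).toRingHom
    (prod_choose_mul_permanent_X hk β α)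
  rw [map_mul, map_permanent_columnSubmatrix, map_piMatrix_pow_apply] at h
  simpa using h

end ToeplitzPermanent

theorem theorem2 {R : Type*} [CommRing R] (t n k r : ℕ) (a : Fin (t + 1) → R)
    (hn : 1 ≤ n) (hk : 1 ≤ k) (hr : r ≤ k * min n t)
    (β : ToeplitzPermanent.G k r (min n t)) (α : ToeplitzPermanent.G k r t) :
    -- the quotient of the entry by the binomial product exists in `ℤ[X_0, ..., X_t]`, is unique,
    (∃! Q : MvPolynomial (Fin (t + 1)) ℤ,
      (∏ i, (k.choose (ToeplitzPermanent.mult β i) : MvPolynomial (Fin (t + 1)) ℤ)) * Q =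
        (ToeplitzPermanent.piMatrix k r t (MvPolynomial.X : Fin (t + 1) → MvPolynomial (Fin (t + 1)) ℤ) ^ n)
          α (ToeplitzPermanent.pad (Nat.min_le_right n t) β)) ∧
    -- and its value at `a_0, ..., a_t` is the permanent;
    (∀ Q : MvPolynomial (Fin (t + 1)) ℤ,
      (∏ i, (k.choose (ToeplitzPermanent.mult β i) : MvPolynomial (Fin (t + 1)) ℤ)) * Q =
        (ToeplitzPermanent.piMatrix k r t (MvPolynomial.X : Fin (t + 1) → MvPolynomial (Fin (t + 1)) ℤ) ^ n)
          α (ToeplitzPermanent.pad (Nat.min_le_right n t) β) →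
      (ToeplitzPermanent.columnSubmatrix hk a β α).permanent = MvPolynomial.aeval a Q) ∧
    -- the formula in `R` with the denominators cleared;
    (∏ i, (k.choose (ToeplitzPermanent.mult β i) : R)) *
        (ToeplitzPermanent.columnSubmatrix hk a β α).permanent =
      (ToeplitzPermanent.piMatrix k r t a ^ n)
        α (ToeplitzPermanent.pad (Nat.min_le_right n t) β) ∧
    -- the formula in `R` itself, whenever the binomial coefficients are invertible in `R`.
    ((∀ i, IsUnit (k.choose (ToeplitzPermanent.mult β i) : R)) →
      (ToeplitzPermanent.columnSubmatrix hk a β α).permanent =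
        (∏ i, Ring.inverse (k.choose (ToeplitzPermanent.mult β i) : R)) *
          (ToeplitzPermanent.piMatrix k r t a ^ n)
            α (ToeplitzPermanent.pad (Nat.min_le_right n t) β)) := by
  have hX := ToeplitzPermanent.prod_choose_mul_permanent_X hk β α
  have hne := ToeplitzPermanent.prod_choose_ne_zero (t := t) β
  have hR := ToeplitzPermanent.prod_choose_mul_permanent hk a β α
  refine ⟨⟨_, hX, fun Q hQ => mul_left_cancel₀ hne (hQ.trans hX.symm)⟩, fun Q hQ => ?_, hR,
    fun hu => ?_⟩
  -- Any such `Q` is the generic permanent, and permanents commute with ring homomorphisms.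
  · rw [mul_left_cancel₀ hne (hQ.trans hX.symm)]
    have h := ToeplitzPermanent.map_permanent_columnSubmatrix
      (MvPolynomial.aeval a : MvPolynomial (Fin (t + 1)) ℤ →ₐ[ℤ] R).toRingHom hk
      MvPolynomial.X β α
    simpa using h.symm
  · rw [← hR, ← mul_assoc, ← Finset.prod_mul_distrib,
      Finset.prod_eq_one fun i _ => Ring.inverse_mul_cancel _ (hu i), one_mul]
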